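/- A diffeology on a set $X$ is a family of maps into $X$ (plots) from Euclidean domains that contains the constant maps, is closed under smooth reparametrization, and is local. A vector space diffeology on a real vector space $V$ is a diffeology for which addition $V\times V\to V$ and scalar multiplication $\mathbb{R}\times V\to V$ are smooth ($\mathbb{R}$ with its standard diffeology, products with the product diffeology). The vector space diffeology generated by a set of maps $\mathbb{R}\to V$ is the smallest vector space diffeology on $V$ of which these maps are plots. A diffeological vector space $V$ is the smooth direct sum of subspaces $V_1,V_2$ if $V=V_1\oplus V_2$ algebraically and, under the identification $(v_1,v_2)\mapsto v_1+v_2$, the diffeology of $V$ coincides with the product diffeology on $V_1\oplus V_2$ of the subset diffeologies on $V_1$ and $V_2$ inherited from $V$. Let $\Delta_{\mathbb{Q}}:\mathbb{R}\to\mathbb{R}$ be $0$ on $\mathbb{Q}$ and $1$ on $\mathbb{R}\setminus\mathbb{Q}$, let $e_1=(1,0)$, $e_2=(0,1)$, and let $V$ be $\mathbb{R}^2$ with the vector space diffeology generated by $p(x)=(|x|,|x|)$ and $q(x)=(0,\Delta_{\mathbb{Q}}(x))$. **Theorem.** (i) $V$ is the smooth direct sum of $\mathrm{Span}(e_1)$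 and $\mathrm{Span}(e_2)$. (ii) The subset diffeology on $\mathrm{Span}(e_1)$ is the vector space diffeology on $\mathrm{Span}(e_1)$ generated by $x\mapsto(|x|,0)$. (iii) The subset diffeology on $\mathrm{Span}(e_2)$ is the vector space diffeology on $\mathrm{Span}(e_2)$ generated by $x\mapsto(0,|x|)$ and $x\mapsto(0,\Delta_{\mathbb{Q}}(x))$. (iv) The function $H_1:\mathbb{R}\to\mathbb{R}$ with $H_1(x)=e^{-1/x^2}$ for $x>0$ and $H_1(x)=0$ for $x\le 0$ is $C^\infty$, and there is a $C^\infty$ function $H_2:\mathbb{R}\to\mathbb{R}$ such that, for all $x\in\mathbb{R}$, $$|x| = 2x\,\Delta_{\mathbb{Q}}(H_1(x)) - 2x\,\Delta_{\mathbb{Q}}(H_2(x)) + x .$$ -/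

import Mathlib

open Diffeology
open scoped ContDiff

namespace SmoothSum

/-- The pullback diffeology along `f : X → Y`: a map `p` into `X` is a plot iff `f ∘ p` is a plot
of `Y`. -/
@[reducible] def pullbackDiffeology {X Y : Type*} (f : X → Y) (D : DiffeologicalSpace Y) :
    DiffeologicalSpace X where
  plots n := {p | @IsPlot Y D n (f ∘ p)}
  constant_plots x := @isPlot_const Y D _ (f x)
  plot_reparam hp hg := @isPlot_reparam Y D _ _ _ _ hp hg
  locality hp := D.locality fun x ↦
    let ⟨u, hu, hxu, h⟩ := hp x
    ⟨u, hu, hxu, fun hgu hg ↦ h hgu hg⟩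

/-- The product diffeology: a map into `X × Y` is a plot iff both components are plots. -/
@[reducible] def prodDiffeology {X Y : Type*} (D : DiffeologicalSpace X)
    (D' : DiffeologicalSpace Y) : DiffeologicalSpace (X × Y) :=
  pullbackDiffeology Prod.fst D ⊓ pullbackDiffeology Prod.snd D'

section VectorSpaces

variable {V : Type*} [AddCommGroup V] [Module ℝ V]

/-- The subset diffeology on a vector subspace `W` of `V`. -/
@[reducible] def subsetDiffeology (D : DiffeologicalSpace V) (W : Submodule ℝ V) :
    DiffeologicalSpace W :=
  pullbackDiffeology (Subtype.val : W → V) D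

/-- `D` is a vector space diffeology on `V`: the addition `V × V → V` and the scalar
multiplication `ℝ × V → V` are smooth, where products carry the product diffeology and `ℝ` its
standard diffeology. -/
structure IsVectorSpaceDiffeology (D : DiffeologicalSpace V) : Prop where
  smooth_add : @DSmooth (V × V) V (prodDiffeology D D) D (fun x ↦ x.1 + x.2)
  smooth_smul : @DSmooth (ℝ × V) V (prodDiffeology inferInstance D) D (fun x ↦ x.1 • x.2)

/-- A map `f : ℝ → V` as a map on the one-dimensional Euclidean space, the domain that plots
in one real variable have in Mathlib. -/
def onLine {X : Type*} (f : ℝ → X) : EuclideanSpace ℝ (Fin 1) → X := fun t ↦ f (t 0)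

/-- The vector space diffeology on `V` generated by a set `S` of maps `ℝ → V`: the smallest
vector space diffeology (the one with the fewest plots) of which all maps in `S` are plots. -/
@[reducible] def vectorSpaceDiffeology (S : Set (ℝ → V)) : DiffeologicalSpace V :=
  sInf {D | IsVectorSpaceDiffeology D ∧ ∀ f ∈ S, @IsPlot V D 1 (onLine f)}

/-- The vector space diffeology generated by `S` is the least vector space diffeology for which
all members of `S` are plots. -/
theorem isLeast_vectorSpaceDiffeology (S : Set (ℝ → V)) :
    IsLeast {D | IsVectorSpaceDiffeology D ∧ ∀ f ∈ S, @IsPlot V D 1 (onLine f)}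
      (vectorSpaceDiffeology S) := by
  refine ⟨⟨⟨fun n p hp ↦ ?_, fun n p hp ↦ ?_⟩, fun f hf ↦ ?_⟩, fun D hD ↦ sInf_le hD⟩
  · have h := DiffeologicalSpace.isPlot_inf_iff.1 hp
    refine DiffeologicalSpace.isPlot_sInf_iff.2 fun D hD ↦ hD.1.smooth_add n p ?_
    exact DiffeologicalSpace.isPlot_inf_iff.2
      ⟨DiffeologicalSpace.isPlot_sInf_iff.1 h.1 D hD, DiffeologicalSpace.isPlot_sInf_iff.1 h.2 D hD⟩
  · have h := DiffeologicalSpace.isPlot_inf_iff.1 hp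
    refine DiffeologicalSpace.isPlot_sInf_iff.2 fun D hD ↦ hD.1.smooth_smul n p ?_
    exact DiffeologicalSpace.isPlot_inf_iff.2
      ⟨h.1, DiffeologicalSpace.isPlot_sInf_iff.1 h.2 D hD⟩
  · exact DiffeologicalSpace.isPlot_sInf_iff.2 fun D hD ↦ hD.2 f hf

/-- `V`, with the diffeology `D`, is the smooth direct sum of its subspaces `V₁` and `V₂`: it is
their algebraic direct sum, and under the identification `(v₁, v₂) ↦ v₁ + v₂` of `V₁ × V₂` with `V`
the diffeology of `V` is the product of the subset diffeologies. -/
def IsSmoothDirectSum (D : DiffeologicalSpace V) (V₁ V₂ : Submodule ℝ V) : Prop :=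
  IsCompl V₁ V₂ ∧
    pullbackDiffeology (fun v : V₁ × V₂ ↦ (v.1 : V) + (v.2 : V)) D =
      prodDiffeology (subsetDiffeology D V₁) (subsetDiffeology D V₂)

end VectorSpaces

open Classical in
/-- The function `Δ_ℚ`: `0` at rational numbers and `1` at irrational ones. -/
noncomputable def deltaQ (x : ℝ) : ℝ := if ∃ r : ℚ, (r : ℝ) = x then 0 else 1

/-- The first standard basis vector of `ℝ²`. -/
def e₁ : ℝ × ℝ := (1, 0)

/-- The second standard basis vector of `ℝ²`. -/
def e₂ : ℝ × ℝ := (0, 1)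

theorem mem_span_e₁ (a : ℝ) : ((a, 0) : ℝ × ℝ) ∈ Submodule.span ℝ {e₁} :=
  Submodule.mem_span_singleton.2 ⟨a, by simp [e₁]⟩

theorem mem_span_e₂ (a : ℝ) : ((0, a) : ℝ × ℝ) ∈ Submodule.span ℝ {e₂} :=
  Submodule.mem_span_singleton.2 ⟨a, by simp [e₂]⟩

/-- The diffeology of `V`: the vector space diffeology on `ℝ²` generated by
`x ↦ (|x|, |x|)` and `x ↦ (0, Δ_ℚ(x))`. -/
@[reducible] noncomputable def planeDiffeology : DiffeologicalSpace (ℝ × ℝ) :=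
  vectorSpaceDiffeology {fun x ↦ (|x|, |x|), fun x ↦ (0, deltaQ x)}

/-- The function equal to `exp (-1 / x²)` for `x > 0` and to `0` for `x ≤ 0`. -/
noncomputable def H₁ (x : ℝ) : ℝ := if 0 < x then Real.exp (-1 / x ^ 2) else 0

end SmoothSum

/-!
Parts (i)-(iii) reduce to the formula of part (iv). Since `H₁` and `H₂` are smooth, the formula
writes `x ↦ |x| v` as a combination, with smooth coefficients, of reparametrizations of
`x ↦ Δ_ℚ(x) v` (`IsVectorSpaceDiffeology.isPlot_abs_smul`). Hence `(0, |x|)` is a plot of the plane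
and, subtracting it from `(|x|, |x|)`, so is `(|x|, 0)`. The inclusions and projections of
`Span e₁ ⊕ Span e₂` therefore map generators to plots; as a linear map with this property is smooth
(`isPlot_linearMap_comp`), the sum is smooth and the summands carry the generated diffeologies
(`isSmoothDirectSum_of_generators`).

For (iv), it suffices that `H₂` be irrational for `x < 0`, and rational exactly where `H₁` is for
`x > 0`. The choice is `H₂ = φ ∘ H₁`, where `φ : ℝ → ℝ` is smooth, `φ 0` is irrational, and for
`t ≠ 0` the number `φ t` is rational if and only if `t` is (`exists_contDiff_rat_iff_rat`). Such a
`φ` comes from a back-and-forth construction. Start from `x ↦ x + √2` and go through the rationals,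
adding each time a tiny multiple of a bump function that vanishes at the finitely many points
already settled, so as to make the value at a given rational rational, or to make a given rational
the value at some rational point. The bumps are so small that the series converges in `C^∞` and
that `φ - id` stays `1/2`-Lipschitz; this keeps `φ` injective, so that a rational number attained at
a settled rational point is attained nowhere else.
-/

namespace SmoothSum

/-! ### Vector space diffeologies -/

section VectorSpaces

variable {V W : Type*} [AddCommGroup V] [Module ℝ V] [AddCommGroup W] [Module ℝ W]

theorem IsVectorSpaceDiffeology.isPlot_add {D : DiffeologicalSpace V}
    (hD : IsVectorSpaceDiffeology D) {n : ℕ} {p q : EuclideanSpace ℝ (Fin n) → V}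
    (hp : IsPlot p) (hq : IsPlot q) : IsPlot (fun t ↦ p t + q t) :=
  hD.smooth_add n (fun t ↦ (p t, q t)) (DiffeologicalSpace.isPlot_inf_iff.2 ⟨hp, hq⟩)

theorem IsVectorSpaceDiffeology.isPlot_smul {D : DiffeologicalSpace V}
    (hD : IsVectorSpaceDiffeology D) {n : ℕ} {a : EuclideanSpace ℝ (Fin n) → ℝ}
    {p : EuclideanSpace ℝ (Fin n) → V} (ha : ContDiff ℝ ∞ a) (hp : IsPlot p) :
    IsPlot (fun t ↦ a t • p t) :=
  hD.smooth_smul n (fun t ↦ (a t, p t)) (DiffeologicalSpace.isPlot_inf_iff.2 ⟨ha.isPlot, hp⟩)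

theorem IsVectorSpaceDiffeology.pullback {D : DiffeologicalSpace W}
    (hD : IsVectorSpaceDiffeology D) (L : V →ₗ[ℝ] W) :
    IsVectorSpaceDiffeology (pullbackDiffeology L D) where
  smooth_add n p hp := by
    have h := DiffeologicalSpace.isPlot_inf_iff.1 hp
    have h' := hD.isPlot_add (p := fun t ↦ L (p t).1) (q := fun t ↦ L (p t).2) h.1 h.2
    simp only [← map_add] at h'
    exact h'
  smooth_smul n p hp := by
    have h := DiffeologicalSpace.isPlot_inf_iff.1 hp
    have ha : ContDiff ℝ ∞ (fun t ↦ (p t).1) := IsPlot.contDiff h.1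
    have h' := hD.isPlot_smul (p := fun t ↦ L (p t).2) ha h.2
    simp only [← map_smul] at h'
    exact h'

theorem isVectorSpaceDiffeology_vectorSpaceDiffeology (S : Set (ℝ → V)) :
    IsVectorSpaceDiffeology (vectorSpaceDiffeology S) :=
  (isLeast_vectorSpaceDiffeology S).1.1

theorem isPlot_onLine_of_mem {S : Set (ℝ → V)} {f : ℝ → V} (hf : f ∈ S) :
    @IsPlot V (vectorSpaceDiffeology S) 1 (onLine f) :=
  (isLeast_vectorSpaceDiffeology S).1.2 f hf

/-- A linear map out of a generated vector space diffeology is smooth as soon as it maps the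
generators to plots. -/
theorem isPlot_linearMap_comp {S : Set (ℝ → V)} {E : DiffeologicalSpace W}
    (hE : IsVectorSpaceDiffeology E) (L : V →ₗ[ℝ] W)
    (hS : ∀ f ∈ S, @IsPlot W E 1 (onLine fun x ↦ L (f x))) {n : ℕ}
    {p : EuclideanSpace ℝ (Fin n) → V} (hp : @IsPlot V (vectorSpaceDiffeology S) n p) :
    @IsPlot W E n fun t ↦ L (p t) :=
  DiffeologicalSpace.isPlot_sInf_iff.1 hp (pullbackDiffeology L E) ⟨hE.pullback L, hS⟩

/-- If the projections and the inclusions of an algebraic direct sum `V = V₁ ⊕ V₂` map generators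
to plots, then the sum is smooth and the subset diffeologies are the generated ones. -/
theorem isSmoothDirectSum_of_generators {V₁ V₂ : Submodule ℝ V} (hV : IsCompl V₁ V₂)
    {S : Set (ℝ → V)} {S₁ : Set (ℝ → V₁)} {S₂ : Set (ℝ → V₂)}
    (hS₁ : ∀ f ∈ S₁, @IsPlot V (vectorSpaceDiffeology S) 1 (onLine fun x ↦ (f x : V)))
    (hS₂ : ∀ f ∈ S₂, @IsPlot V (vectorSpaceDiffeology S) 1 (onLine fun x ↦ (f x : V)))
    (hP₁ : ∀ f ∈ S, @IsPlot V₁ (vectorSpaceDiffeology S₁) 1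
      (onLine fun x ↦ V₁.projectionOnto V₂ hV (f x)))
    (hP₂ : ∀ f ∈ S, @IsPlot V₂ (vectorSpaceDiffeology S₂) 1
      (onLine fun x ↦ V₂.projectionOnto V₁ hV.symm (f x))) :
    IsSmoothDirectSum (vectorSpaceDiffeology S) V₁ V₂ ∧
      subsetDiffeology (vectorSpaceDiffeology S) V₁ = vectorSpaceDiffeology S₁ ∧
      subsetDiffeology (vectorSpaceDiffeology S) V₂ = vectorSpaceDiffeology S₂ := by
  have hD := isVectorSpaceDiffeology_vectorSpaceDiffeology S
  have inc₁ {n : ℕ} {p : EuclideanSpace ℝ (Fin n) → V₁}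
      (hp : @IsPlot V₁ (vectorSpaceDiffeology S₁) n p) :
      @IsPlot V (vectorSpaceDiffeology S) n fun t ↦ (p t : V) :=
    isPlot_linearMap_comp hD V₁.subtype hS₁ hp
  have inc₂ {n : ℕ} {p : EuclideanSpace ℝ (Fin n) → V₂}
      (hp : @IsPlot V₂ (vectorSpaceDiffeology S₂) n p) :
      @IsPlot V (vectorSpaceDiffeology S) n fun t ↦ (p t : V) :=
    isPlot_linearMap_comp hD V₂.subtype hS₂ hp
  have proj₁ {n : ℕ} {p : EuclideanSpace ℝ (Fin n) → V}
      (hp : @IsPlot V (vectorSpaceDiffeology S) n p) :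
      @IsPlot V₁ (vectorSpaceDiffeology S₁) n fun t ↦ V₁.projectionOnto V₂ hV (p t) :=
    isPlot_linearMap_comp (isVectorSpaceDiffeology_vectorSpaceDiffeology S₁) _ hP₁ hp
  have proj₂ {n : ℕ} {p : EuclideanSpace ℝ (Fin n) → V}
      (hp : @IsPlot V (vectorSpaceDiffeology S) n p) :
      @IsPlot V₂ (vectorSpaceDiffeology S₂) n fun t ↦ V₂.projectionOnto V₁ hV.symm (p t) :=
    isPlot_linearMap_comp (isVectorSpaceDiffeology_vectorSpaceDiffeology S₂) _ hP₂ hp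
  refine ⟨⟨hV, ?_⟩, ?_, ?_⟩
  · ext n p
    rw [DiffeologicalSpace.isPlot_inf_iff]
    constructor
    · intro hp
      have h₁ := inc₁ (proj₁ (p := fun t ↦ ((p t).1 : V) + (p t).2) hp)
      have h₂ := inc₂ (proj₂ (p := fun t ↦ ((p t).1 : V) + (p t).2) hp)
      simp only [map_add, Submodule.projectionOnto_apply_left,
        Submodule.projectionOnto_apply_right, add_zero, zero_add] at h₁ h₂
      exact ⟨h₁, h₂⟩
    · rintro ⟨h₁, h₂⟩
      exact hD.isPlot_add (p := fun t ↦ ((p t).1 : V)) (q := fun t ↦ ((p t).2 : V)) h₁ h₂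
  · ext n p
    refine ⟨fun hp ↦ ?_, inc₁⟩
    have h := proj₁ (p := fun t ↦ (p t : V)) hp
    simpa only [Submodule.projectionOnto_apply_left] using h
  · ext n p
    refine ⟨fun hp ↦ ?_, inc₂⟩
    have h := proj₂ (p := fun t ↦ (p t : V)) hp
    simpa only [Submodule.projectionOnto_apply_left] using h

end VectorSpaces

/-! ### Smoothness of `H₁` -/

open Polynomial Filter Topology in
theorem tendsto_polynomial_inv_mul_H₁_zero (p : ℝ[X]) :
    Tendsto (fun x ↦ p.eval x⁻¹ * H₁ x) (𝓝 0) (𝓝 0) := by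
  simp only [H₁, mul_ite, mul_zero]
  refine Tendsto.if ?_ tendsto_const_nhds
  have h : Tendsto (fun y : ℝ ↦ p.eval y * Real.exp (-y ^ 2)) atTop (𝓝 0) := by
    refine squeeze_zero_norm' ?_ (by simpa using p.tendsto_div_exp_atTop.norm)
    filter_upwards [eventually_ge_atTop 1] with y hy
    rw [norm_mul, Real.norm_of_nonneg (Real.exp_pos _).le, Real.norm_eq_abs, div_eq_mul_inv,
      ← Real.exp_neg]
    gcongr
    nlinarith
  refine (h.comp tendsto_inv_nhdsGT_zero).congr' <| mem_of_superset self_mem_nhdsWithin fun x _ ↦ ?_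
  simp [div_eq_mul_inv]

open Polynomial Filter Topology in
theorem hasDerivAt_polynomial_inv_mul_H₁ (p : ℝ[X]) (x : ℝ) :
    HasDerivAt (fun x ↦ p.eval x⁻¹ * H₁ x)
      ((2 * X ^ 3 * p - X ^ 2 * derivative p).eval x⁻¹ * H₁ x) x := by
  rcases lt_trichotomy x 0 with hx | rfl | hx
  · rw [H₁, if_neg hx.not_gt, mul_zero]
    refine (hasDerivAt_const _ 0).congr_of_eventuallyEq ?_
    filter_upwards [gt_mem_nhds hx] with y hy
    rw [H₁, if_neg (not_lt.2 hy.le), mul_zero]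
  · have h0 : H₁ 0 = 0 := by simp [H₁]
    rw [h0, mul_zero, hasDerivAt_iff_tendsto_slope]
    refine ((tendsto_polynomial_inv_mul_H₁_zero (p * X)).mono_left inf_le_left).congr fun x ↦ ?_
    simp [slope_def_field, h0, div_eq_mul_inv, mul_right_comm]
  · have := ((p.hasDerivAt x⁻¹).mul ((hasDerivAt_pow 2 x⁻¹).neg).exp).comp x
      (hasDerivAt_inv hx.ne')
    convert! this.congr_of_eventuallyEq _ using 1
    · simp [H₁, hx, div_eq_mul_inv]
      ring
    · filter_upwards [lt_mem_nhds hx] with y hy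
      simp [H₁, hy, div_eq_mul_inv]

open Polynomial in
/-- The functions `p(1/x) * H₁ x`, for polynomials `p`, are stable under differentiation. -/
theorem contDiff_polynomial_inv_mul_H₁ (m : ℕ) (p : ℝ[X]) :
    ContDiff ℝ m (fun x ↦ p.eval x⁻¹ * H₁ x) := by
  have hd (p : ℝ[X]) : Differentiable ℝ (fun x ↦ p.eval x⁻¹ * H₁ x) := fun x ↦
    (hasDerivAt_polynomial_inv_mul_H₁ p x).differentiableAt
  induction m generalizing p with
  | zero => exact contDiff_zero.2 (hd p).continuous
  | succ m ihm =>
    rw [show ((m + 1 : ℕ) : WithTop ℕ∞) = m + 1 from rfl]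
    refine contDiff_succ_iff_deriv.2 ⟨hd p, by simp, ?_⟩
    convert! ihm (2 * X ^ 3 * p - X ^ 2 * derivative p) using 2
    exact (hasDerivAt_polynomial_inv_mul_H₁ p _).deriv

theorem contDiff_H₁ : ContDiff ℝ ∞ H₁ :=
  contDiff_infty.2 fun m ↦ by simpa using contDiff_polynomial_inv_mul_H₁ m 1

/-! ### A smooth bijection matching `ℚ \ {0}` with `ℚ` -/

/-- A bump function at `t₀` that vanishes on a given finite set; its small multiples have small
derivatives up to order `n`. -/
theorem exists_bump_with_small_derivatives (S : Finset ℝ) {t₀ : ℝ} (ht₀ : t₀ ∉ S) (n : ℕ) {η : ℝ}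
    (hη : 0 < η) :
    ∃ g : ℝ → ℝ, ContDiff ℝ ∞ g ∧ (∀ s ∈ S, g s = 0) ∧
      (∃ ρ > 0, ∀ t, |t - t₀| < ρ → g t = 1) ∧
      ∃ ε₀ > 0, ∀ ε : ℝ, |ε| < ε₀ → ∀ k ≤ n, ∀ x, ‖iteratedFDeriv ℝ k (ε • g) x‖ ≤ η := by
  obtain ⟨r, hr, hrS⟩ := Metric.isOpen_iff.1 S.finite_toSet.isClosed.isOpen_compl t₀
    (by simpa using ht₀)
  let g : ContDiffBump t₀ := ⟨r / 3, r / 2, by positivity, by linarith⟩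
  have hg : ContDiff ℝ ∞ g := g.contDiff
  refine ⟨g, hg, fun s hs ↦ ?_, ⟨r / 3, by positivity, fun t ht ↦ ?_⟩, ?_⟩
  · refine g.zero_of_le_dist ?_
    by_contra! h
    exact hrS (Metric.mem_ball.2 (h.trans (by change r / 2 < r; linarith))) hs
  · exact g.one_of_mem_closedBall (Metric.mem_closedBall.2 (by rw [Real.dist_eq]; exact ht.le))
  · have hC (k : ℕ) : ∃ C, ∀ x, ‖iteratedFDeriv ℝ k g x‖ ≤ C :=
      (hg.continuous_iteratedFDeriv (m := k)
        (by exact_mod_cast le_top)).bounded_above_of_compact_support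
        (g.hasCompactSupport.iteratedFDeriv k)
    choose C hC using hC
    have hC0 (k : ℕ) : 0 ≤ C k := (norm_nonneg _).trans (hC k 0)
    -- A common bound for all the orders `k ≤ n`, made positive by the summand `1`.
    let M := 1 + ∑ k ∈ Finset.range (n + 1), C k
    have hM : 0 < M := by have := Finset.sum_nonneg fun k (_ : k ∈ Finset.range (n + 1)) ↦ hC0 k
                          positivity
    refine ⟨η / M, by positivity, fun ε hε k hk x ↦ ?_⟩
    rw [iteratedFDeriv_const_smul_apply (hg.contDiffAt.of_le (by exact_mod_cast le_top)),
      norm_smul, Real.norm_eq_abs]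
    have hk : C k ≤ M := by
      have := Finset.single_le_sum (fun k _ ↦ hC0 k) (Finset.mem_range.2 (Nat.lt_succ_of_le hk))
      linarith
    calc |ε| * ‖iteratedFDeriv ℝ k g x‖ ≤ η / M * M := by
          gcongr
          exact (hC k x).trans hk
      _ = η := by field_simp

/-- A stage `(φ, S)` of the back-and-forth construction: `φ` is a small perturbation of a
translation, and on the finite set `S` it takes its final values, irrational at `0` and elsewhere
rational at rational points. The Lipschitz constants of the perturbations stay below `1 / 2`. -/
structure IsStage (n : ℕ) (P : (ℝ → ℝ) × Finset ℝ) : Prop where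
  contDiff : ContDiff ℝ ∞ P.1
  lipschitz : ∀ x y, |(P.1 x - x) - (P.1 y - y)| ≤ 1 / 2 * (1 - (1 / 2) ^ n) * |x - y|
  zero_mem : 0 ∈ P.2
  irrational_zero : Irrational (P.1 0)
  rat : ∀ t ∈ P.2, t ≠ 0 → t ∈ Set.range ((↑) : ℚ → ℝ) ∧ P.1 t ∈ Set.range ((↑) : ℚ → ℝ)

/-- The stage `P'` refines `P`: the values on the finite set of `P` are kept and the functions are
`2⁻ⁿ⁻²`-close in `Cⁿ⁺¹`. -/
structure Refines (n : ℕ) (P P' : (ℝ → ℝ) × Finset ℝ) : Prop where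
  subset : P.2 ⊆ P'.2
  eqOn : ∀ t ∈ P.2, P'.1 t = P.1 t
  close : ∀ k ≤ n + 1, ∀ x, ‖iteratedFDeriv ℝ k (P'.1 - P.1) x‖ ≤ 1 / 4 * (1 / 2) ^ n

theorem abs_sub_le_of_norm_iteratedFDeriv_one_le {f : ℝ → ℝ} (hf : ContDiff ℝ ∞ f) {C : ℝ}
    (hC : ∀ x, ‖iteratedFDeriv ℝ 1 f x‖ ≤ C) (x y : ℝ) : |f x - f y| ≤ C * |x - y| :=
  convex_univ.norm_image_sub_le_of_norm_fderiv_le (𝕜 := ℝ)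
    (fun x _ ↦ (hf.differentiable (by simp)).differentiableAt)
    (fun x _ ↦ (norm_iteratedFDeriv_one (𝕜 := ℝ) (x := x) f).symm.trans_le (hC x))
    (Set.mem_univ y) (Set.mem_univ x)

theorem bijective_of_lipschitz_sub_id {φ : ℝ → ℝ} (hφ : Continuous φ)
    (h : ∀ x y, |(φ x - x) - (φ y - y)| ≤ 1 / 2 * |x - y|) : Function.Bijective φ := by
  constructor
  · intro x y hxy
    have := h x y
    rw [hxy, show φ y - x - (φ y - y) = -(x - y) by ring, abs_neg] at this
    have := abs_nonneg (x - y)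
    exact sub_eq_zero.1 (abs_eq_zero.1 (by linarith))
  · refine hφ.surjective ?_ ?_
    · refine Filter.tendsto_atTop_mono' _ ?_ (f₁ := fun x : ℝ ↦ 1 / 2 * x + φ 0) ?_
      · filter_upwards [Filter.eventually_ge_atTop 0] with x hx
        have := h x 0
        rw [sub_zero, sub_zero, abs_of_nonneg hx] at this
        linarith [(abs_le.1 this).1]
      · exact Filter.tendsto_atTop_add_const_right _ _
          (Filter.tendsto_id.const_mul_atTop (by norm_num))
    · refine Filter.tendsto_atBot_mono' _ ?_ (f₁ := fun x : ℝ ↦ 1 / 2 * x + φ 0) ?_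
      · filter_upwards [Filter.eventually_le_atBot 0] with x hx
        have := h x 0
        rw [sub_zero, sub_zero, abs_of_nonpos hx] at this
        linarith [(abs_le.1 this).2]
      · exact Filter.tendsto_atBot_add_const_right _ _
          (Filter.tendsto_id.const_mul_atBot (by norm_num))

theorem IsStage.lipschitz_half {n : ℕ} {P : (ℝ → ℝ) × Finset ℝ} (hP : IsStage n P) (x y : ℝ) :
    |(P.1 x - x) - (P.1 y - y)| ≤ 1 / 2 * |x - y| := by
  refine (hP.lipschitz x y).trans (mul_le_mul_of_nonneg_right ?_ (abs_nonneg _))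
  have : (0 : ℝ) ≤ (1 / 2) ^ n := by positivity
  linarith

theorem IsStage.mono {n : ℕ} {P : (ℝ → ℝ) × Finset ℝ} (hP : IsStage n P) : IsStage (n + 1) P where
  __ := hP
  lipschitz x y := by
    refine (hP.lipschitz x y).trans (mul_le_mul_of_nonneg_right ?_ (abs_nonneg _))
    have : (0 : ℝ) ≤ (1 / 2) ^ n := by positivity
    rw [pow_succ]
    linarith

theorem Refines.refl (n : ℕ) (P : (ℝ → ℝ) × Finset ℝ) : Refines n P P where
  subset := subset_rfl
  eqOn _ _ := rfl
  close k _ x := by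
    rw [sub_self, show (0 : ℝ → ℝ) = fun _ ↦ 0 from rfl, iteratedFDeriv_fun_zero]
    simp only [Pi.zero_apply, norm_zero]
    positivity

/-- A small smooth perturbation vanishing on `S` gives a refinement that settles one more rational
point. -/
theorem IsStage.perturb {n : ℕ} {P : (ℝ → ℝ) × Finset ℝ} (hP : IsStage n P) {δ : ℝ → ℝ}
    (hδ : ContDiff ℝ ∞ δ) (hδS : ∀ s ∈ P.2, δ s = 0)
    (hδn : ∀ k ≤ n + 1, ∀ x, ‖iteratedFDeriv ℝ k δ x‖ ≤ 1 / 4 * (1 / 2) ^ n) {t : ℝ}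
    (ht : t ∈ Set.range ((↑) : ℚ → ℝ)) (ht' : P.1 t + δ t ∈ Set.range ((↑) : ℚ → ℝ)) :
    IsStage (n + 1) (P.1 + δ, insert t P.2) ∧ Refines n P (P.1 + δ, insert t P.2) where
  left :=
    { contDiff := hP.contDiff.add hδ
      lipschitz := fun x y ↦ by
        have h₁ := hP.lipschitz x y
        have h₂ := abs_sub_le_of_norm_iteratedFDeriv_one_le hδ (hδn 1 (by lia)) x y
        calc |(P.1 x + δ x - x) - (P.1 y + δ y - y)|
            = |((P.1 x - x) - (P.1 y - y)) + (δ x - δ y)| := by ring_nf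
          _ ≤ _ := (abs_add_le _ _).trans (add_le_add h₁ h₂)
          _ = _ := by ring
      zero_mem := Finset.mem_insert_of_mem hP.zero_mem
      irrational_zero := by
        simpa [hδS 0 hP.zero_mem] using hP.irrational_zero
      rat := fun s hs hs0 ↦ by
        rcases Finset.mem_insert.1 hs with rfl | hs
        · exact ⟨ht, ht'⟩
        · simpa [hδS s hs] using hP.rat s hs hs0 }
  right :=
    { subset := Finset.subset_insert _ _
      eqOn := fun s hs ↦ by simp [hδS s hs]
      close := by simpa using hδn }

theorem IsStage.exists_refines_mem {n : ℕ} {P : (ℝ → ℝ) × Finset ℝ} (hP : IsStage n P) (r : ℚ) :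
    ∃ P', IsStage (n + 1) P' ∧ Refines n P P' ∧ (r : ℝ) ∈ P'.2 := by
  by_cases hr : (r : ℝ) ∈ P.2
  · exact ⟨P, hP.mono, .refl n P, hr⟩
  obtain ⟨g, hg, hgS, ⟨ρ, hρ, hgρ⟩, ε₀, hε₀, hε⟩ :=
    exists_bump_with_small_derivatives P.2 hr (n + 1) (η := 1 / 4 * (1 / 2) ^ n) (by positivity)
  obtain ⟨y, hy, hy'⟩ := exists_rat_btwn (lt_add_of_pos_right (P.1 r) hε₀)
  have h := hP.perturb (δ := (y - P.1 r) • g) (contDiff_const.smul hg)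
    (fun s hs ↦ by simp [hgS s hs]) (hε _ (abs_lt.2 ⟨by linarith, by linarith⟩)) ⟨r, rfl⟩
    ⟨y, by simp [hgρ r (by simpa using hρ)]⟩
  exact ⟨_, h.1, h.2, Finset.mem_insert_self _ _⟩

theorem IsStage.exists_refines_mem_image {n : ℕ} {P : (ℝ → ℝ) × Finset ℝ} (hP : IsStage n P)
    (r : ℚ) : ∃ P', IsStage (n + 1) P' ∧ Refines n P P' ∧ ∃ t ∈ P'.2, P'.1 t = r := by
  obtain ⟨t₀, ht₀⟩ :=
    (bijective_of_lipschitz_sub_id hP.contDiff.continuous hP.lipschitz_half).2 (r : ℝ)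
  by_cases hS : t₀ ∈ P.2
  · exact ⟨P, hP.mono, .refl n P, t₀, hS, ht₀⟩
  obtain ⟨g, hg, hgS, ⟨ρ, hρ, hgρ⟩, ε₀, hε₀, hε⟩ :=
    exists_bump_with_small_derivatives P.2 hS (n + 1) (η := 1 / 4 * (1 / 2) ^ n) (by positivity)
  -- The preimage `t₀` of `r` is moved to a rational point `t` nearby.
  obtain ⟨t, ht, ht'⟩ : ∃ t : ℚ, |(t : ℝ) - t₀| < ρ ∧ |P.1 t - r| < ε₀ := by
    have hc := hP.contDiff.continuous.continuousAt (x := t₀)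
    obtain ⟨ρ', hρ', h⟩ := Metric.continuousAt_iff.1 hc ε₀ hε₀
    obtain ⟨t, ht⟩ := Rat.denseRange_cast (𝕜 := ℝ).exists_dist_lt t₀ (lt_min hρ hρ')
    rw [dist_comm] at ht
    exact ⟨t, ht.trans_le (min_le_left _ _), by
      simpa [Real.dist_eq, ht₀] using h (ht.trans_le (min_le_right _ _))⟩
  have hval : P.1 t + ((r - P.1 t) • g) t = r := by simp [hgρ t ht]
  have h := hP.perturb (δ := (r - P.1 t) • g) (contDiff_const.smul hg)
    (fun s hs ↦ by simp [hgS s hs]) (hε _ (by rwa [abs_sub_comm])) ⟨t, rfl⟩ ⟨r, hval.symm⟩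
  exact ⟨_, h.1, h.2, t, Finset.mem_insert_self _ _, hval⟩

/-- Smooth back-and-forth: a `C^∞` function that takes an irrational value at `0` and elsewhere is
rational exactly at the rational points. -/
theorem exists_contDiff_rat_iff_rat :
    ∃ φ : ℝ → ℝ, ContDiff ℝ ∞ φ ∧ Irrational (φ 0) ∧
      ∀ t, t ≠ 0 → (φ t ∈ Set.range ((↑) : ℚ → ℝ) ↔ t ∈ Set.range ((↑) : ℚ → ℝ)) := by
  obtain ⟨task, htask⟩ := exists_surjective_nat (ℚ ⊕ ℚ)
  have step (n : ℕ) (P : (ℝ → ℝ) × Finset ℝ) : ∃ P', IsStage n P →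
      IsStage (n + 1) P' ∧ Refines n P P' ∧
        (task n).elim (fun r : ℚ ↦ (r : ℝ) ∈ P'.2) (fun r : ℚ ↦ ∃ t ∈ P'.2, P'.1 t = r) := by
    by_cases hP : IsStage n P
    · cases task n with
      | inl r => exact (hP.exists_refines_mem r).imp fun _ h _ ↦ h
      | inr r => exact (hP.exists_refines_mem_image r).imp fun _ h _ ↦ h
    · exact ⟨P, fun h ↦ (hP h).elim⟩
  choose next hnext using step
  let u : ℕ → (ℝ → ℝ) × Finset ℝ := fun n ↦ n.rec (fun x ↦ x + √2, {0}) next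
  have hu (n : ℕ) : IsStage n (u n) := by
    induction n with
    | zero =>
      exact
        { contDiff := contDiff_id.add contDiff_const
          lipschitz := fun x y ↦ by simp [u]
          zero_mem := by simp [u]
          irrational_zero := by simpa [u] using irrational_sqrt_two
          rat := fun t ht ht0 ↦ (ht0 (by simpa [u] using ht)).elim }
    | succ n ih => exact (hnext n (u n) ih).1
  have href (n : ℕ) : Refines n (u n) (u (n + 1)) := (hnext n (u n) (hu n)).2.1
  have hdone (n : ℕ) := (hnext n (u n) (hu n)).2.2
  change ∀ n, (task n).elim (fun r : ℚ ↦ (r : ℝ) ∈ (u (n + 1)).2)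
    (fun r : ℚ ↦ ∃ t ∈ (u (n + 1)).2, (u (n + 1)).1 t = r) at hdone
  have hsum : Summable fun n : ℕ ↦ (1 / 4 : ℝ) * (1 / 2) ^ n := summable_geometric_two.mul_left _
  let φ : ℝ → ℝ := fun x ↦ (u 0).1 x + ∑' n, ((u (n + 1)).1 - (u n).1) x
  have hφ : ContDiff ℝ ∞ φ := by
    refine (hu 0).contDiff.add (contDiff_tsum_of_eventually (N := ⊤)
      (fun n ↦ (hu (n + 1)).contDiff.sub (hu n).contDiff) (fun k _ ↦ hsum) fun k _ ↦ ?_)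
    rw [Nat.cofinite_eq_atTop]
    filter_upwards [Filter.eventually_ge_atTop k] with n hn x
    exact (href n).close k (by lia) x
  have hlim (x : ℝ) : Filter.Tendsto (fun n ↦ (u n).1 x) Filter.atTop (nhds (φ x)) := by
    have hs : Summable fun n ↦ ((u (n + 1)).1 - (u n).1) x :=
      hsum.of_norm_bounded fun n ↦ by simpa using (href n).close 0 (by lia) x
    have := hs.hasSum.tendsto_sum_nat.const_add ((u 0).1 x)
    simpa only [Pi.sub_apply, Finset.sum_range_sub (fun n ↦ (u n).1 x), add_sub_cancel] using! this
  have hstable (n : ℕ) {t : ℝ} (ht : t ∈ (u n).2) : φ t = (u n).1 t := by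
    have h (m : ℕ) (hm : n ≤ m) : t ∈ (u m).2 ∧ (u m).1 t = (u n).1 t := by
      induction m, hm using Nat.le_induction with
      | base => exact ⟨ht, rfl⟩
      | succ m _ ih => exact ⟨(href m).subset ih.1, ((href m).eqOn t ih.1).trans ih.2⟩
    refine tendsto_nhds_unique (hlim t) (tendsto_const_nhds.congr' ?_)
    filter_upwards [Filter.eventually_ge_atTop n] with m hm
    exact (h m hm).2.symm
  have hinj : Function.Injective φ := by
    refine (bijective_of_lipschitz_sub_id hφ.continuous fun x y ↦ ?_).1
    exact le_of_tendsto ((((hlim x).sub_const x).sub ((hlim y).sub_const y)).abs)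
      (Filter.Eventually.of_forall fun n ↦ (hu n).lipschitz_half x y)
  have h0 : Irrational (φ 0) := by
    rw [hstable 0 (hu 0).zero_mem]
    exact (hu 0).irrational_zero
  refine ⟨φ, hφ, h0, fun t ht0 ↦ ⟨?_, ?_⟩⟩
  · rintro ⟨r, hr⟩
    obtain ⟨n, hn⟩ := htask (.inr r)
    obtain ⟨s, hs, hsr⟩ : ∃ s ∈ (u (n + 1)).2, (u (n + 1)).1 s = r := by simpa [hn] using hdone n
    have hst : s = t := hinj (by rw [hstable (n + 1) hs, hsr, hr])
    exact ((hu (n + 1)).rat t (hst ▸ hs) ht0).1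
  · rintro ⟨r, rfl⟩
    obtain ⟨n, hn⟩ := htask (.inl r)
    have hs : (r : ℝ) ∈ (u (n + 1)).2 := by simpa [hn] using hdone n
    rw [hstable (n + 1) hs]
    exact ((hu (n + 1)).rat r hs ht0).2

/-! ### The absolute value in terms of `Δ_ℚ` -/

theorem deltaQ_of_mem {x : ℝ} (hx : x ∈ Set.range ((↑) : ℚ → ℝ)) : deltaQ x = 0 := if_pos hx

theorem deltaQ_of_irrational {x : ℝ} (hx : Irrational x) : deltaQ x = 1 := if_neg hx

theorem deltaQ_congr {x y : ℝ}
    (h : x ∈ Set.range ((↑) : ℚ → ℝ) ↔ y ∈ Set.range ((↑) : ℚ → ℝ)) : deltaQ x = deltaQ y := by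
  by_cases hy : y ∈ Set.range ((↑) : ℚ → ℝ)
  · rw [deltaQ_of_mem hy, deltaQ_of_mem (h.2 hy)]
  · rw [deltaQ_of_irrational hy, deltaQ_of_irrational fun hx ↦ hy (h.1 hx)]

/-- With `φ` from `exists_contDiff_rat_iff_rat`, the function `H₂ = φ ∘ H₁` is irrational on the
negative half-line, where `H₁` vanishes, and rational exactly where `H₁` is on the positive one. -/
theorem exists_contDiff_abs_eq : ∃ H₂ : ℝ → ℝ, ContDiff ℝ ∞ H₂ ∧ ∀ x : ℝ,
    |x| = 2 * x * deltaQ (H₁ x) - 2 * x * deltaQ (H₂ x) + x := by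
  obtain ⟨φ, hφ, h0, hrat⟩ := exists_contDiff_rat_iff_rat
  refine ⟨φ ∘ H₁, hφ.comp contDiff_H₁, fun x ↦ ?_⟩
  rcases le_or_gt x 0 with hx | hx
  · have hH : H₁ x = 0 := if_neg hx.not_gt
    rw [Function.comp_apply, hH, deltaQ_of_irrational h0, deltaQ_of_mem ⟨0, by simp⟩,
      abs_of_nonpos hx]
    ring
  · have hH : H₁ x ≠ 0 := by
      rw [H₁, if_pos hx]
      exact (Real.exp_pos _).ne'
    rw [Function.comp_apply, deltaQ_congr (hrat _ hH), abs_of_pos hx]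
    ring

/-- If `x ↦ Δ_ℚ(x) v` is a plot, then so is `x ↦ |x| v`. -/
theorem IsVectorSpaceDiffeology.isPlot_abs_smul {V : Type*} [AddCommGroup V] [Module ℝ V]
    {D : DiffeologicalSpace V} (hD : IsVectorSpaceDiffeology D) {v : V}
    (hv : IsPlot (onLine fun x ↦ deltaQ x • v)) : IsPlot (onLine fun x ↦ |x| • v) := by
  obtain ⟨H₂, hH₂, hH⟩ := exists_contDiff_abs_eq
  have hx : ContDiff ℝ ∞ fun t : EuclideanSpace ℝ (Fin 1) ↦ t 0 := by fun_prop
  have reparam {H : ℝ → ℝ} (hH : ContDiff ℝ ∞ H) :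
      IsPlot fun t : EuclideanSpace ℝ (Fin 1) ↦ deltaQ (H (t 0)) • v :=
    isPlot_reparam (f := fun t : EuclideanSpace ℝ (Fin 1) ↦ !₂[H (t 0)]) hv (by
      refine contDiff_euclidean.2 fun i ↦ ?_
      simpa [Subsingleton.elim i 0] using! hH.comp hx)
  have h := hD.isPlot_add (hD.isPlot_add
    (hD.isPlot_smul (contDiff_const (c := (2 : ℝ)) |>.mul hx) (reparam contDiff_H₁))
    (hD.isPlot_smul (contDiff_const (c := (-2 : ℝ)) |>.mul hx) (reparam hH₂)))
    (hD.isPlot_smul hx (isPlot_const (x := v)))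
  convert! h using 2 with t
  rw [onLine, hH (t 0)]
  module

/-! ### The plane -/

theorem isCompl_span_e₁_e₂ : IsCompl (Submodule.span ℝ {e₁}) (Submodule.span ℝ {e₂}) := by
  refine ⟨Submodule.disjoint_def.2 fun x h₁ h₂ ↦ ?_, codisjoint_iff_le_sup.2 fun x _ ↦ ?_⟩
  · obtain ⟨a, rfl⟩ := Submodule.mem_span_singleton.1 h₁
    obtain ⟨b, hb⟩ := Submodule.mem_span_singleton.1 h₂
    have : 0 = a := by simpa [e₁, e₂] using congrArg Prod.fst hb
    simp [← this]
  · exact Submodule.mem_sup.2 ⟨_, mem_span_e₁ x.1, _, mem_span_e₂ x.2, by simp⟩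

theorem projectionOnto_span_e₁ (a b : ℝ) :
    (Submodule.span ℝ {e₁}).projectionOnto (Submodule.span ℝ {e₂}) isCompl_span_e₁_e₂ (a, b) =
      ⟨(a, 0), mem_span_e₁ a⟩ := by
  have h₁ := Submodule.projectionOnto_apply_left isCompl_span_e₁_e₂ ⟨(a, 0), mem_span_e₁ a⟩
  have h₂ := Submodule.projectionOnto_apply_right isCompl_span_e₁_e₂ ⟨(0, b), mem_span_e₂ b⟩
  rw [show (a, b) = (a, 0) + (0, b) by simp, map_add, h₁, h₂, add_zero]

theorem projectionOnto_span_e₂ (a b : ℝ) :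
    (Submodule.span ℝ {e₂}).projectionOnto (Submodule.span ℝ {e₁}) isCompl_span_e₁_e₂.symm (a, b) =
      ⟨(0, b), mem_span_e₂ b⟩ := by
  have h₁ := Submodule.projectionOnto_apply_right isCompl_span_e₁_e₂.symm ⟨(a, 0), mem_span_e₁ a⟩
  have h₂ := Submodule.projectionOnto_apply_left isCompl_span_e₁_e₂.symm ⟨(0, b), mem_span_e₂ b⟩
  rw [show (a, b) = (a, 0) + (0, b) by simp, map_add, h₁, h₂, zero_add]

theorem isPlot_planeDiffeology_abs_right :
    @IsPlot _ planeDiffeology 1 (onLine fun x ↦ (0, |x|)) := by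
  have h := (isVectorSpaceDiffeology_vectorSpaceDiffeology _).isPlot_abs_smul (v := e₂)
    (D := planeDiffeology) (by simpa [e₂] using isPlot_onLine_of_mem (.inr rfl))
  simpa [e₂] using h

theorem isPlot_planeDiffeology_abs_left :
    @IsPlot _ planeDiffeology 1 (onLine fun x ↦ (|x|, 0)) := by
  have hD : IsVectorSpaceDiffeology planeDiffeology :=
    isVectorSpaceDiffeology_vectorSpaceDiffeology _
  have h := hD.isPlot_add (isPlot_onLine_of_mem (.inl rfl))
    (hD.isPlot_smul (contDiff_const (c := (-1 : ℝ))) isPlot_planeDiffeology_abs_right)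
  simpa [onLine] using! h

end SmoothSum

theorem mainTheorem1 :
    SmoothSum.IsSmoothDirectSum SmoothSum.planeDiffeology
        (Submodule.span ℝ {SmoothSum.e₁}) (Submodule.span ℝ {SmoothSum.e₂}) ∧
      SmoothSum.subsetDiffeology SmoothSum.planeDiffeology (Submodule.span ℝ {SmoothSum.e₁}) =
        SmoothSum.vectorSpaceDiffeology
          {fun x : ℝ ↦ ⟨(|x|, 0), SmoothSum.mem_span_e₁ |x|⟩} ∧
      SmoothSum.subsetDiffeology SmoothSum.planeDiffeology (Submodule.span ℝ {SmoothSum.e₂}) =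
        SmoothSum.vectorSpaceDiffeology
          {fun x : ℝ ↦ ⟨(0, |x|), SmoothSum.mem_span_e₂ |x|⟩,
            fun x : ℝ ↦ ⟨(0, SmoothSum.deltaQ x), SmoothSum.mem_span_e₂ (SmoothSum.deltaQ x)⟩} ∧
      ContDiff ℝ ∞ SmoothSum.H₁ ∧
      ∃ H₂ : ℝ → ℝ, ContDiff ℝ ∞ H₂ ∧ ∀ x : ℝ,
        |x| = 2 * x * SmoothSum.deltaQ (SmoothSum.H₁ x) - 2 * x * SmoothSum.deltaQ (H₂ x) + x := by
  open SmoothSum in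
  have key := isSmoothDirectSum_of_generators isCompl_span_e₁_e₂
    (S := {fun x ↦ (|x|, |x|), fun x ↦ (0, deltaQ x)})
    (S₁ := {fun x : ℝ ↦ ⟨(|x|, 0), mem_span_e₁ |x|⟩})
    (S₂ := {fun x : ℝ ↦ ⟨(0, |x|), mem_span_e₂ |x|⟩,
      fun x : ℝ ↦ ⟨(0, deltaQ x), mem_span_e₂ (deltaQ x)⟩})
    (by
      rintro _ rfl
      exact isPlot_planeDiffeology_abs_left)
    (by
      rintro _ (rfl | rfl)
      · exact isPlot_planeDiffeology_abs_right
      · exact isPlot_onLine_of_mem (.inr rfl))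
    (by
      rintro _ (rfl | rfl) <;> simp only [projectionOnto_span_e₁]
      · exact isPlot_onLine_of_mem rfl
      · exact @isPlot_const _ (_) _ _)
    (by
      rintro _ (rfl | rfl) <;> simp only [projectionOnto_span_e₂]
      · exact isPlot_onLine_of_mem (.inl rfl)
      · exact isPlot_onLine_of_mem (.inr rfl))
  exact ⟨key.1, key.2.1, key.2.2, SmoothSum.contDiff_H₁, SmoothSum.exists_contDiff_abs_eq⟩
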